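/- **Setting.** Let $Z$ be a bounded metric space with at least two points. For a family $\mathcal U$ of subsets of $Z$ put $\operatorname{mesh}\mathcal U=\sup_{U\in\mathcal U}\operatorname{diam}U$ and, for an open covering, $L(\mathcal U)=\inf_{z\in Z}\min\{\sup_{U\in\mathcal U}\operatorname{dist}(z,Z\setminus U),\operatorname{mesh}\mathcal U\}$ (with $\operatorname{dist}(z,\emptyset)=\infty$). A covering is $m$-colored if it is a union $\bigcup_{c\in C}\mathcal U^c$, $|C|=m$, of families $\mathcal U^c$ each consisting of pairwise disjoint sets. The capacity dimension $\operatorname{cdim}Z$ is the least integer $m\ge0$ for which there is $\delta>0$ such that for all sufficiently small $\tau>0$ there is an $(m+1)$-colored open covering $\mathcal U$ of $Z$ with $\operatorname{mesh}\mathcal U\le\tau$ and $L(\mathcal U)\ge\delta\tau$. A hyperbolic approximation $X$ of $Z$ with parameter $r\in(0,1/6]$ is the following graph. Let $k_0$ be the largest integer with $\operatorname{diam}Z<r^{k_0}$, and for each integer $k\ge k_0$ let $V_k\subset Z$ be a maximal set whose distinct points are at distance $\ge r^k$. The vertex set $V$ is the disjoint union of the $V_k$; for $v\in V_k$ write $\ell(v)=k$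 and let $B(v)$, $\overline B(v)$ be the open and closed balls in $Z$ of radius $2r^k$ about $v$. Distinct $v,v'$ are joined by an edge if and only if either $\ell(v)=\ell(v')$ and $\overline B(v)\cap\overline B(v')\ne\emptyset$, or $\ell(v')=\ell(v)+1$ and $B(v')\subset B(v)$ (or vice versa). $|vv'|$ denotes the path metric with edges of length 1. Let $|C|=n+1$. A sequence $\mathcal U_j$, $j\ge0$, of $C$-colored open coverings of $Z$ by nonempty sets with $\mathcal U_0^c=\{Z\}$ for every $c\in C$ is called adapted to $X$ if (1) $\operatorname{mesh}\mathcal U_j<r^j$ for all $j\ge1$; (2) for every $j\ge0$ and $v\in V$ with $\ell(v)=j+1$ there is $U\in\mathcal U_j$ with $B(v)\subset U$; (3) for every $c\in C$ and different members $U\in\mathcal U_j^c$, $U'\in\mathcal U_{j'}^c$, $j'\le j$ (members with different indices count as different), the set $B(U)=\bigcup\{B(v):\ell(v)=j+1,\ B(v)\cap U\neq\emptyset\}$ satisfies $B(U)\subset U'$ or $B(U)\cap U'=\emptyset$. For $c\in C$ let $T_c$ be the graph whose vertex set is the disjoint union of the $\mathcal U_j^c$, $j\ge0$; $U'\in\mathcal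 U^c_{j'}$ is an ancestor of $U\in\mathcal U_j^c$ if $j'<j$ and $U\subset U'$, and $U$ is joined by an edge to its ancestors of maximal index. Let $\mathcal L$ be the path metric of $T_c$. Let $f_c:V\to T_c$ send $v$ to the member $U\in\mathcal U^c_{j'}$ with $B(v)\subset U$ and with $j'\le\max\{\ell(v)-1,0\}$ maximal. Let $f=\prod_cf_c:V\to\prod_cT_c$, where the product carries the $\ell_1$-metric, $|f(v)f(v')|=\sum_c\mathcal L(f_c(v),f_c(v'))$. **Theorem.** For every integer $n\ge0$ there are constants $a_1,a_2>0$, $b\ge0$, depending only on $|C|=n+1$, such that for every bounded metric space $Z$ with at least two points and $\operatorname{cdim}Z=n$ the following holds. (a) There is $r_0>0$ such that for every $r\in(0,r_0)$ there is a sequence of $(n+1)$-colored open coverings of $Z$ that is adapted to every hyperbolic approximation of $Z$ with parameter $r$. (b) Let $X$ be a hyperbolic approximation of $Z$ with parameter $r<\min\{\operatorname{diam}Z,1/\operatorname{diam}Z\}$ and let $(\mathcal U_j)$ be any $(n+1)$-colored sequence adapted to $X$. Then $X$ is connected, every $T_c$ is a tree, and $f$ is quasi-isometric: $$a_1|vv'|-b\le|f(v)f(v')|\le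 a_2|vv'|+b\qquad\text{for all }v,v'\in V .$$ Moreover $\mathcal L(f_c(v),f_c(v'))\le2|vv'|+1$ for all $c\in C$ and $v,v'\in V$; and if $B(v)\cap B(v')\neq\emptyset$ for all adjacent $v,v'\in V$, then every $f_c$ is $2$-Lipschitz, $\mathcal L(f_c(v),f_c(v'))\le2|vv'|$. -/

import Mathlib

open scoped ENNReal

noncomputable section

namespace ColoredTrees

/-! ### Colored coverings and capacity dimension -/

/-- `𝒰 c` is the subfamily of color `c`. The union over all colors is an open covering of `Z`, and
each single-colored subfamily is disjoint. -/
structure IsColoredCover {Z C : Type*} [MetricSpace Z] (𝒰 : C → Set (Set Z)) : Prop where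
  isOpen : ∀ c, ∀ U ∈ 𝒰 c, IsOpen U
  disjoint : ∀ c, (𝒰 c).PairwiseDisjoint id
  covers : ∀ z : Z, ∃ c, ∃ U ∈ 𝒰 c, z ∈ U

/-- The mesh: supremum of the diameters of the members. -/
def mesh {Z C : Type*} [MetricSpace Z] (𝒰 : C → Set (Set Z)) : ℝ≥0∞ :=
  ⨆ c, ⨆ U ∈ 𝒰 c, Metric.ediam U

/-- The Lebesgue number at a point, `min (sup_U dist (z, Z \ U)) mesh`; the distance to the empty
set is `∞`. -/
def lebesgueAt {Z C : Type*} [MetricSpace Z] (𝒰 : C → Set (Set Z)) (z : Z) : ℝ≥0∞ :=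
  min (⨆ c, ⨆ U ∈ 𝒰 c, Metric.infEDist z Uᶜ) (mesh 𝒰)

/-- The Lebesgue number of a covering. -/
def lebesgue {Z C : Type*} [MetricSpace Z] (𝒰 : C → Set (Set Z)) : ℝ≥0∞ :=
  ⨅ z, lebesgueAt 𝒰 z

/-- There is `δ > 0` such that for all sufficiently small `τ > 0` there is an `(m+1)`-colored open
covering of mesh at most `τ` and Lebesgue number at least `δ τ`. -/
def CapDimProperty (Z : Type*) [MetricSpace Z] (m : ℕ) : Prop :=
  ∃ δ : ℝ, 0 < δ ∧ ∃ τ₀ : ℝ, 0 < τ₀ ∧ ∀ τ : ℝ, 0 < τ → τ < τ₀ →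
    ∃ 𝒰 : Fin (m + 1) → Set (Set Z), IsColoredCover 𝒰 ∧
      mesh 𝒰 ≤ ENNReal.ofReal τ ∧ ENNReal.ofReal (δ * τ) ≤ lebesgue 𝒰

/-- The capacity dimension of `Z` is (finite and equal to) `n`. -/
def IsCapDim (Z : Type*) [MetricSpace Z] (n : ℕ) : Prop :=
  IsLeast {m | CapDimProperty Z m} n

/-! ### Hyperbolic approximations -/

/-- `a`-separated subsets: distinct points are at distance at least `a`. -/
def IsSeparatedBy {Z : Type*} [MetricSpace Z] (a : ℝ) (S : Set Z) : Prop :=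
  S.Pairwise fun x y => a ≤ dist x y

/-- The data defining a hyperbolic approximation of `Z` with parameter `r`: the level `k₀` of the
root, and a maximal `r ^ k`-separated set `V k` for each `k ≥ k₀`. (The values of `V` below `k₀` are
irrelevant.) -/
structure HypApprox (Z : Type*) [MetricSpace Z] (r : ℝ) where
  pos : 0 < r
  le_sixth : r ≤ 1 / 6
  k₀ : ℤ
  isGreatest : IsGreatest {k : ℤ | Metric.diam (Set.univ : Set Z) < r ^ k} k₀
  V : ℤ → Set Z
  maximal : ∀ k, k₀ ≤ k → Maximal (IsSeparatedBy (r ^ k)) (V k)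

namespace HypApprox

variable {Z : Type*} [MetricSpace Z] {r : ℝ} (X : HypApprox Z r)

/-- The vertex set: the disjoint union of the `V k`, `k ≥ k₀`. -/
def Vertex : Type _ := {p : ℤ × Z // X.k₀ ≤ p.1 ∧ p.2 ∈ X.V p.1}

variable {X}

/-- The level of a vertex. -/
def Vertex.level (v : X.Vertex) : ℤ := v.1.1

/-- The point of `Z` underlying a vertex. -/
def Vertex.center (v : X.Vertex) : Z := v.1.2

/-- The open ball `B(v)` of radius `2 r ^ k`, where `k` is the level of `v`. -/
def Vertex.ball (v : X.Vertex) : Set Z := Metric.ball v.center (2 * r ^ v.level)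

/-- The closed ball with the center and the radius of `B(v)`. -/
def Vertex.closedBall (v : X.Vertex) : Set Z := Metric.closedBall v.center (2 * r ^ v.level)

/-- Radial adjacency: `w` lies one level above `v` and `B(w) ⊆ B(v)`. -/
def Radial (v w : X.Vertex) : Prop := w.level = v.level + 1 ∧ w.ball ⊆ v.ball

/-- Horizontal adjacency: distinct vertices of the same level whose closed balls intersect. -/
def Horizontal (v w : X.Vertex) : Prop :=
  v ≠ w ∧ v.level = w.level ∧ (v.closedBall ∩ w.closedBall).Nonempty

variable (X)

/-- The hyperbolic approximation as a graph; the metric on the vertices is its path metric. -/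
def graph : SimpleGraph X.Vertex where
  Adj v w := Horizontal v w ∨ Radial v w ∨ Radial w v
  symm := ⟨by
    rintro v w (⟨h1, h2, h3⟩ | h | h)
    · exact Or.inl ⟨h1.symm, h2.symm, by rwa [Set.inter_comm]⟩
    · exact Or.inr (Or.inr h)
    · exact Or.inr (Or.inl h)⟩
  loopless := ⟨by
    rintro v (⟨h, -⟩ | ⟨h, -⟩ | ⟨h, -⟩)
    · exact h rfl
    · omega
    · omega⟩

end HypApprox

/-! ### Sequences of colored coverings -/

/-- A sequence of colored open coverings by nonempty sets, the covering of index `0` consisting of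
`Z` alone in each color. -/
structure CoverSeq (Z C : Type*) [MetricSpace Z] where
  family : ℕ → C → Set (Set Z)
  isCover : ∀ j, IsColoredCover (family j)
  nonempty : ∀ j c, ∀ U ∈ family j c, U.Nonempty
  zero : ∀ c, family 0 c = {Set.univ}

/-- `B(U)` for a member `U` of the `j`-th covering: the union of the balls `B(v)` of the vertices
`v` of level `j + 1` that meet `U`. -/
def hull {Z : Type*} [MetricSpace Z] {r : ℝ} (X : HypApprox Z r) (j : ℕ) (U : Set Z) : Set Z :=
  ⋃ v ∈ {v : X.Vertex | v.level = (j : ℤ) + 1 ∧ (v.ball ∩ U).Nonempty}, v.ball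

/-- The three conditions linking a sequence of coverings to a hyperbolic approximation. In the
separation property, members are different as soon as they differ as sets or by their index. -/
structure CoverSeq.Adapted {Z C : Type*} [MetricSpace Z] {r : ℝ} (𝒰 : CoverSeq Z C)
    (X : HypApprox Z r) : Prop where
  mesh_lt : ∀ j : ℕ, 1 ≤ j → mesh (𝒰.family j) < ENNReal.ofReal (r ^ j)
  ball_subset : ∀ (j : ℕ) (v : X.Vertex), v.level = (j : ℤ) + 1 →
    ∃ c, ∃ U ∈ 𝒰.family j c, v.ball ⊆ U
  separation : ∀ (c : C) (j j' : ℕ), j' ≤ j → ∀ U ∈ 𝒰.family j c, ∀ U' ∈ 𝒰.family j' c,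
    (j, U) ≠ (j', U') → hull X j U ⊆ U' ∨ Disjoint (hull X j U) U'

/-! ### Colored trees and the maps into them -/

namespace CoverSeq

variable {Z C : Type*} [MetricSpace Z] (𝒰 : CoverSeq Z C) (c : C)

/-- Vertices of the colored tree `T_c`: the disjoint union over `j` of the families of color `c`. -/
def TreeVertex : Type _ := {p : ℕ × Set Z // p.2 ∈ 𝒰.family p.1 c}

variable {𝒰 c}

/-- The level of a vertex of `T_c`. -/
def TreeVertex.level (u : 𝒰.TreeVertex c) : ℕ := u.1.1

/-- The covering element underlying a vertex of `T_c`. -/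
def TreeVertex.set (u : 𝒰.TreeVertex c) : Set Z := u.1.2

/-- `a` is an ancestor of `u`. -/
def IsAncestor (a u : 𝒰.TreeVertex c) : Prop := a.level < u.level ∧ u.set ⊆ a.set

/-- `a` is an ancestor of `u` of maximal level. -/
def IsParent (a u : 𝒰.TreeVertex c) : Prop :=
  IsAncestor a u ∧ ∀ b : 𝒰.TreeVertex c, IsAncestor b u → b.level ≤ a.level

variable (𝒰 c)

/-- The colored tree `T_c` as a graph. -/
def tree : SimpleGraph (𝒰.TreeVertex c) where
  Adj u w := IsParent u w ∨ IsParent w u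
  symm := ⟨fun _ _ h => h.symm⟩
  loopless := ⟨by
    rintro u (h | h)
    · exact lt_irrefl _ h.1.1
    · exact lt_irrefl _ h.1.1⟩

variable {r : ℝ} {X : HypApprox Z r}

open Classical in
/-- The largest index `j' ≤ max (level v - 1) 0` such that some member of color `c` of the `j'`-th
covering contains `B(v)`. -/
def mapLevel (v : X.Vertex) : ℕ :=
  Nat.findGreatest (fun j => ∃ U ∈ 𝒰.family j c, v.ball ⊆ U) (v.level - 1).toNat

lemma mapLevel_spec (v : X.Vertex) : ∃ U ∈ 𝒰.family (𝒰.mapLevel c v) c, v.ball ⊆ U := by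
  classical
  have h0 : ∃ U ∈ 𝒰.family 0 c, v.ball ⊆ U := ⟨Set.univ, by simp [𝒰.zero], Set.subset_univ _⟩
  exact Nat.findGreatest_spec (P := fun j => ∃ U ∈ 𝒰.family j c, v.ball ⊆ U) (Nat.zero_le _) h0

/-- The map `f_c`: a vertex `v` goes to the member of color `c` and of index `mapLevel` that
contains `B(v)` (it is unique, since members of equal color and index are disjoint). Vertices of
level `≤ 0`, among them the root, go to the root `Z` of `T_c`. -/
def treeMap (v : X.Vertex) : 𝒰.TreeVertex c :=
  ⟨(𝒰.mapLevel c v, Classical.choose (𝒰.mapLevel_spec c v)),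
    (Classical.choose_spec (𝒰.mapLevel_spec c v)).1⟩

/-- The `ℓ¹` distance between `f v` and `f w` in the product of the trees, `f = ∏ f_c`. -/
def prodDist [Fintype C] (v w : X.Vertex) : ℝ :=
  ∑ c, ((𝒰.tree c).dist (𝒰.treeMap c v) (𝒰.treeMap c w) : ℝ)

end CoverSeq

end ColoredTrees

end

namespace ColoredTrees

/-! ### Existence of adapted sequences -/

section Saturation

variable {Z : Type*} [MetricSpace Z]

/-! Existence of adapted sequences. In a covering of mesh at most `r ^ j / 2` and comparable
Lebesgue number, replace each member by its core, the points at depth more than `12 * r ^ (j + 1)`.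
Cores of one color are far apart on the scale `r ^ (j + 1)`, yet the cores still contain all balls
of radius `2 * r ^ (j + 1)`. Then enlarge each core by all chains of neighborhoods of same-colored
cores of larger index. A later neighborhood is thereby either swallowed or missed, which is the
separation property. Geometric decay keeps the enlargement within distance `r ^ (j + 1)`
(`WellSpaced.dist_le_of_chain`), so mesh and disjointness survive.

Upper bound. Any path in `X` can be replaced, without gaining length, by one that goes through
parents, uses at most one horizontal edge and then goes through children (`exists_joined`). By
separation, `f_c` moves by at most 2 along a radial edge (`Adapted.treeMap_of_radial`) and at most 3
along a horizontal one, whence `2 * d + 1`.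

Lower bound. Each edge of `T_c` changes the set of ancestors by one element, so distances in `T_c`
dominate symmetric differences of ancestor sets. Let `m` be the last level at which `v` and `w` are
still close. For each positive index `j > m` below the level of `v`, some color has a member of
index `j` containing `B(v)`; it is too small to contain the center of `w` as well. Counting these
indices for `v` and for `w`, over all colors, recovers `|vw|` up to 5
(`Adapted.graph_dist_le_sum_dist`). -/

/-- Two points are linked if they lie in the `5 r ^ (i + 1)`-neighborhood of a common member of
`W i` for some `i ≥ j`. -/
def Link (W : ℕ → Set (Set Z)) (r : ℝ) (j : ℕ) (x y : Z) : Prop :=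
  ∃ i, j ≤ i ∧ ∃ V ∈ W i, x ∈ Metric.thickening (5 * r ^ (i + 1)) V ∧
    y ∈ Metric.thickening (5 * r ^ (i + 1)) V

/-- The variant of `Link` that only uses the indices below `M`. -/
def LinkBelow (W : ℕ → Set (Set Z)) (r : ℝ) (M j : ℕ) (x y : Z) : Prop :=
  ∃ i, j ≤ i ∧ i < M ∧ ∃ V ∈ W i, x ∈ Metric.thickening (5 * r ^ (i + 1)) V ∧
    y ∈ Metric.thickening (5 * r ^ (i + 1)) V

/-- The set `U` of index `j` together with all chains of links of larger index that start in it. -/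
def saturation (W : ℕ → Set (Set Z)) (r : ℝ) (j : ℕ) (U : Set Z) : Set Z :=
  {y | ∃ x ∈ U, Relation.ReflTransGen (Link W r (j + 1)) x y}

/-- Members of `W i` have small diameter and are far apart from each other, relative to `r ^ i`. -/
structure WellSpaced (W : ℕ → Set (Set Z)) (r : ℝ) : Prop where
  pos : 0 < r
  le : r ≤ 1 / 24
  dist_le : ∀ i, ∀ V ∈ W i, ∀ x ∈ V, ∀ y ∈ V, dist x y ≤ r ^ i / 2
  gap : ∀ i, ∀ V ∈ W i, ∀ V' ∈ W i, V ≠ V' → ∀ x ∈ V, ∀ y ∈ V', 12 * r ^ (i + 1) < dist x y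

variable {W : ℕ → Set (Set Z)} {r : ℝ}

/-- A chain is finite, so its indices are bounded. The bound is the starting point of a downward
induction on `j`. -/
lemma exists_linkBelow_chain {j : ℕ} {x y : Z} (h : Relation.ReflTransGen (Link W r j) x y) :
    ∃ M, Relation.ReflTransGen (LinkBelow W r M j) x y := by
  induction h with
  | refl => exact ⟨0, .refl⟩
  | tail _ hs ih =>
    obtain ⟨M, hM⟩ := ih
    obtain ⟨i, hi, V, hV, hx, hy⟩ := hs
    refine ⟨max M (i + 1), .tail (Relation.ReflTransGen.mono ?_ _ _ hM)
      ⟨i, hi, by omega, V, hV, hx, hy⟩⟩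
    rintro a b ⟨i', h1, h2, h3⟩
    exact ⟨i', h1, by omega, h3⟩

lemma LinkBelow.cases_index {M j : ℕ} {x y : Z} (h : LinkBelow W r M j x y) :
    (∃ V ∈ W j, x ∈ Metric.thickening (5 * r ^ (j + 1)) V ∧
      y ∈ Metric.thickening (5 * r ^ (j + 1)) V) ∨ LinkBelow W r M (j + 1) x y := by
  obtain ⟨i, hi, hM, h⟩ := h
  rcases hi.eq_or_lt with rfl | hlt
  · exact .inl h
  · exact .inr ⟨i, hlt, hM, h⟩

lemma WellSpaced.dist_thickening_lt (hW : WellSpaced W r) {j : ℕ} {V : Set Z} (hV : V ∈ W j)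
    {x y : Z} (hx : x ∈ Metric.thickening (5 * r ^ (j + 1)) V)
    (hy : y ∈ Metric.thickening (5 * r ^ (j + 1)) V) :
    dist x y < r ^ j / 2 + 10 * r ^ (j + 1) := by
  obtain ⟨a, ha, hxa⟩ := Metric.mem_thickening_iff.1 hx
  obtain ⟨b, hb, hyb⟩ := Metric.mem_thickening_iff.1 hy
  have h1 := hW.dist_le j V hV a ha b hb
  have h2 := dist_triangle4 x a b y
  rw [dist_comm b y] at h2
  linarith

lemma WellSpaced.eq_of_near (hW : WellSpaced W r) {j : ℕ} {V V' : Set Z} (hV : V ∈ W j)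
    (hV' : V' ∈ W j) {x y : Z} (hx : x ∈ Metric.thickening (5 * r ^ (j + 1)) V)
    (hy : y ∈ Metric.thickening (5 * r ^ (j + 1)) V') (hxy : dist x y ≤ r ^ (j + 1)) : V = V' := by
  by_contra hne
  obtain ⟨a, ha, hxa⟩ := Metric.mem_thickening_iff.1 hx
  obtain ⟨b, hb, hyb⟩ := Metric.mem_thickening_iff.1 hy
  have h1 := hW.gap j V hV V' hV' hne a ha b hb
  have h2 := dist_triangle4 a x y b
  rw [dist_comm a x] at h2
  have := pow_pos hW.pos (j + 1)
  linarith

/-- Between two visits to index `j` the chain moves by at most `r ^ (j + 1)`, too little to reach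
another member since `5 + 1 + 5 < 12`. So all links of index `j` use one `V` and can be contracted
to a single one. -/
lemma WellSpaced.linkBelow_chain_cases (hW : WellSpaced W r) {M j : ℕ}
    (ih : ∀ x y, Relation.ReflTransGen (LinkBelow W r M (j + 1)) x y → dist x y ≤ r ^ (j + 1))
    {x y : Z} (h : Relation.ReflTransGen (LinkBelow W r M j) x y) :
    Relation.ReflTransGen (LinkBelow W r M (j + 1)) x y ∨
      ∃ V ∈ W j, ∃ x' ∈ Metric.thickening (5 * r ^ (j + 1)) V,
        ∃ y' ∈ Metric.thickening (5 * r ^ (j + 1)) V,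
        Relation.ReflTransGen (LinkBelow W r M (j + 1)) x x' ∧
        Relation.ReflTransGen (LinkBelow W r M (j + 1)) y' y := by
  induction h with
  | refl => exact .inl .refl
  | @tail b c _ hs ihc =>
    rcases hs.cases_index with ⟨V', hV', hb, hc⟩ | hs
    · rcases ihc with ihc | ⟨V, hV, x', hx', y', hy', h1, h2⟩
      · exact .inr ⟨V', hV', b, hb, c, hc, ihc, .refl⟩
      · obtain rfl := hW.eq_of_near hV hV' hy' hb (ih _ _ h2)
        exact .inr ⟨V, hV, x', hx', c, hc, h1, .refl⟩
    · rcases ihc with ihc | ⟨V, hV, x', hx', y', hy', h1, h2⟩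
      · exact .inl (ihc.tail hs)
      · exact .inr ⟨V, hV, x', hx', y', hy', h1, h2.tail hs⟩

/-- Downward induction on `j` from `M`. The contracted chain has extent at most `r ^ j / 2 + (1 + 10
+ 1) * r ^ (j + 1)`, which `r ≤ 1 / 24` bounds by `r ^ j`. -/
lemma WellSpaced.dist_le_of_linkBelow_chain (hW : WellSpaced W r) (M d : ℕ) :
    ∀ j, M ≤ j + d → ∀ x y, Relation.ReflTransGen (LinkBelow W r M j) x y →
      dist x y ≤ r ^ j := by
  induction d with
  | zero =>
    intro j hj x y h
    induction h with
    | refl => simpa using (pow_pos hW.pos j).le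
    | tail _ hs _ =>
      obtain ⟨i, h1, h2, -⟩ := hs
      omega
  | succ d ihd =>
    intro j hj x y h
    have ih := ihd (j + 1) (by omega)
    have hpos := pow_pos hW.pos j
    have hsucc : r ^ (j + 1) ≤ r ^ j / 24 := by
      rw [pow_succ]
      nlinarith [hW.le]
    rcases hW.linkBelow_chain_cases ih h with h | ⟨V, hV, x', hx', y', hy', h1, h2⟩
    · exact (ih _ _ h).trans (by linarith)
    · have h3 := hW.dist_thickening_lt hV hx' hy'
      have h4 := dist_triangle4 x x' y' y
      linarith [ih _ _ h1, ih _ _ h2]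

lemma WellSpaced.dist_le_of_chain (hW : WellSpaced W r) {j : ℕ} {x y : Z}
    (h : Relation.ReflTransGen (Link W r j) x y) : dist x y ≤ r ^ j := by
  obtain ⟨M, hM⟩ := exists_linkBelow_chain h
  exact hW.dist_le_of_linkBelow_chain M M j (by omega) x y hM

lemma subset_saturation (j : ℕ) (U : Set Z) : U ⊆ saturation W r j U :=
  fun x hx => ⟨x, hx, .refl⟩

lemma thickening_subset_saturation {i j : ℕ} (hij : j < i) {U V : Set Z} (hV : V ∈ W i)
    (h : (Metric.thickening (5 * r ^ (i + 1)) V ∩ saturation W r j U).Nonempty) :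
    Metric.thickening (5 * r ^ (i + 1)) V ⊆ saturation W r j U := by
  obtain ⟨y, hy, x, hx, hxy⟩ := h
  exact fun z hz => ⟨x, hx, hxy.tail ⟨i, hij, V, hV, hy, hz⟩⟩

lemma isOpen_saturation {j : ℕ} {U : Set Z} (hU : IsOpen U) : IsOpen (saturation W r j U) := by
  rw [isOpen_iff_mem_nhds]
  rintro y ⟨x, hx, hxy⟩
  rcases hxy.cases_tail with rfl | ⟨z, hxz, i, hi, V, hV, hz, hy⟩
  · exact Filter.mem_of_superset (hU.mem_nhds hx) (subset_saturation j U)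
  · exact Filter.mem_of_superset (Metric.isOpen_thickening.mem_nhds hy)
      (thickening_subset_saturation hi hV ⟨z, hz, x, hx, hxz⟩)

lemma WellSpaced.exists_dist_le (hW : WellSpaced W r) {j : ℕ} {U : Set Z} {y : Z}
    (hy : y ∈ saturation W r j U) : ∃ x ∈ U, dist x y ≤ r ^ (j + 1) := by
  obtain ⟨x, hx, hxy⟩ := hy
  exact ⟨x, hx, hW.dist_le_of_chain hxy⟩

lemma WellSpaced.dist_saturation_le (hW : WellSpaced W r) {j : ℕ} {U : Set Z} (hU : U ∈ W j)
    {x y : Z} (hx : x ∈ saturation W r j U) (hy : y ∈ saturation W r j U) :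
    dist x y ≤ r ^ j / 2 + 2 * r ^ (j + 1) := by
  obtain ⟨a, ha, hxa⟩ := hW.exists_dist_le hx
  obtain ⟨b, hb, hyb⟩ := hW.exists_dist_le hy
  have h2 := dist_triangle4 x a b y
  rw [dist_comm x a] at h2
  linarith [hW.dist_le j U hU a ha b hb]

/-- The constant 5 of `Link` comes from here: 1 for the saturation and 4 for the diameter of a ball
of level `j + 1`. -/
lemma WellSpaced.hull_saturation_subset (hW : WellSpaced W r) (X : HypApprox Z r) (j : ℕ)
    (U : Set Z) : hull X j (saturation W r j U) ⊆ Metric.thickening (5 * r ^ (j + 1)) U := by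
  intro p hp
  simp only [hull, Set.mem_iUnion, Set.mem_ofPred_eq] at hp
  obtain ⟨v, ⟨hv, q, hqv, hq⟩, hpv⟩ := hp
  obtain ⟨x, hx, hxq⟩ := hW.exists_dist_le hq
  have hr : r ^ v.level = r ^ (j + 1) := by
    rw [hv]; exact_mod_cast zpow_natCast r (j + 1)
  rw [HypApprox.Vertex.ball, Metric.mem_ball, hr] at hqv hpv
  refine Metric.mem_thickening_iff.2 ⟨x, hx, ?_⟩
  have h1 := dist_triangle4 p v.center q x
  rw [dist_comm v.center q, dist_comm q x] at h1
  linarith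

lemma WellSpaced.disjoint_thickening_saturation (hW : WellSpaced W r) {j : ℕ} {U U' : Set Z}
    (hU : U ∈ W j) (hU' : U' ∈ W j) (hne : U ≠ U') :
    Disjoint (Metric.thickening (5 * r ^ (j + 1)) U) (saturation W r j U') := by
  rw [Set.disjoint_left]
  intro y hy hy'
  obtain ⟨x, hx, hxy⟩ := hW.exists_dist_le hy'
  obtain ⟨a, ha, hya⟩ := Metric.mem_thickening_iff.1 hy
  have h1 := hW.gap j U hU U' hU' hne a ha x hx
  have h2 := dist_triangle a y x
  rw [dist_comm a y, dist_comm y x] at h2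
  have := pow_pos hW.pos (j + 1)
  linarith

lemma WellSpaced.disjoint_saturation (hW : WellSpaced W r) {j : ℕ} {U U' : Set Z}
    (hU : U ∈ W j) (hU' : U' ∈ W j) (hne : U ≠ U') :
    Disjoint (saturation W r j U) (saturation W r j U') := by
  refine (hW.disjoint_thickening_saturation hU hU' hne).mono_left ?_
  intro y hy
  obtain ⟨x, hx, hxy⟩ := hW.exists_dist_le hy
  refine Metric.mem_thickening_iff.2 ⟨x, hx, ?_⟩
  rw [dist_comm]
  have := pow_pos hW.pos (j + 1)
  linarith

end Saturation

/-! ### Cores of coverings and construction of adapted sequences -/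

section Existence

variable {Z : Type*} [MetricSpace Z]

/-- A core point of `U` has depth above `12 * r ^ (j + 1)`, while the core of another member of that
color lies outside `U`; hence the gap. -/
lemma exists_core_families {C : Type*} {r δ : ℝ} {j : ℕ} (hr : 0 < r) (hδ : 28 * r < δ)
    {𝒰 : C → Set (Set Z)} (h𝒰 : IsColoredCover 𝒰) (hmesh : mesh 𝒰 ≤ ENNReal.ofReal (r ^ j / 2))
    (hL : ENNReal.ofReal (δ * (r ^ j / 2)) ≤ lebesgue 𝒰) :
    ∃ W : C → Set (Set Z), (∀ c, ∀ V ∈ W c, IsOpen V) ∧ (∀ c, ∀ V ∈ W c, V.Nonempty) ∧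
      (∀ c, ∀ V ∈ W c, ∀ x ∈ V, ∀ y ∈ V, dist x y ≤ r ^ j / 2) ∧
      (∀ c, ∀ V ∈ W c, ∀ V' ∈ W c, V ≠ V' → ∀ x ∈ V, ∀ y ∈ V',
        12 * r ^ (j + 1) < dist x y) ∧
      ∀ z, ∃ c, ∃ V ∈ W c, Metric.ball z (2 * r ^ (j + 1)) ⊆ V := by
  set ε : ℝ := 12 * r ^ (j + 1) with hε
  have hp : 0 < r ^ j := pow_pos hr j
  have hp' : 0 < r ^ (j + 1) := pow_pos hr (j + 1)
  let core : Set Z → Set Z := fun U => {z | ENNReal.ofReal ε < Metric.infEDist z Uᶜ}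
  have hcore : ∀ U, core U ⊆ U := by
    intro U z hz
    by_contra hzU
    have h0 : Metric.infEDist z Uᶜ = 0 := Metric.infEDist_zero_of_mem hzU
    simp [core, h0] at hz
  refine ⟨fun c => {V | V.Nonempty ∧ ∃ U ∈ 𝒰 c, core U = V}, ?_, ?_, ?_, ?_, ?_⟩
  · rintro c _ ⟨-, U, hU, rfl⟩
    exact isOpen_lt continuous_const Metric.continuous_infEDist
  · rintro c _ ⟨h, -⟩
    exact h
  · rintro c _ ⟨-, U, hU, rfl⟩ x hx y hy
    have h1 : edist x y ≤ ENNReal.ofReal (r ^ j / 2) := by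
      refine (Metric.edist_le_ediam_of_mem (hcore U hx) (hcore U hy)).trans (le_trans ?_ hmesh)
      exact le_iSup_of_le c (le_iSup₂_of_le U hU le_rfl)
    rw [edist_dist] at h1
    exact (ENNReal.ofReal_le_ofReal_iff (by positivity)).1 h1
  · rintro c _ ⟨-, U, hU, rfl⟩ _ ⟨-, U', hU', rfl⟩ hne x hx y hy
    have hUU' : U ≠ U' := fun h => hne (by rw [h])
    have hy' : y ∈ Uᶜ := fun hyU =>
      Set.disjoint_left.1 (h𝒰.disjoint c hU hU' hUU') hyU (hcore U' hy)
    have h1 : ENNReal.ofReal ε < edist x y := lt_of_lt_of_le hx (Metric.infEDist_le_edist_of_mem hy')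
    rw [edist_dist] at h1
    exact (ENNReal.ofReal_lt_ofReal_iff_of_nonneg (by positivity)).1 h1
  · intro z
    -- Depth 14 is the core depth 12 plus the radius 2 of the ball; `28 * r < δ` makes the Lebesgue
    -- number exceed it.
    have h1 : ENNReal.ofReal (14 * r ^ (j + 1)) < ⨆ c, ⨆ U ∈ 𝒰 c, Metric.infEDist z Uᶜ := by
      refine lt_of_lt_of_le ?_ ((hL.trans (iInf_le _ z)).trans (min_le_left _ _))
      rw [ENNReal.ofReal_lt_ofReal_iff_of_nonneg (by positivity), pow_succ]
      nlinarith
    simp only [lt_iSup_iff] at h1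
    obtain ⟨c, U, hU, hz⟩ := h1
    have hball : Metric.ball z (2 * r ^ (j + 1)) ⊆ core U := by
      intro y hy
      by_contra hcon
      have h2 : Metric.infEDist y Uᶜ ≤ ENNReal.ofReal ε := not_lt.1 hcon
      have h3 : edist z y ≤ ENNReal.ofReal (2 * r ^ (j + 1)) := by
        rw [edist_dist, dist_comm]
        exact ENNReal.ofReal_le_ofReal (Metric.mem_ball.1 hy).le
      have h4 : Metric.infEDist z Uᶜ ≤ edist z y + Metric.infEDist y Uᶜ :=
        Metric.infEDist_le_edist_add_infEDist
      have h5 := h4.trans (add_le_add h3 h2)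
      rw [← ENNReal.ofReal_add (by positivity) (by positivity),
        show 2 * r ^ (j + 1) + ε = 14 * r ^ (j + 1) by rw [hε]; ring] at h5
      exact absurd hz (not_lt.2 h5)
    exact ⟨c, core U, ⟨⟨z, hball (Metric.mem_ball_self (by positivity))⟩, U, hU, rfl⟩, hball⟩

lemma CapDimProperty.exists_adapted [Nonempty Z] {n : ℕ} (h : CapDimProperty Z n) :
    ∃ r₀ : ℝ, 0 < r₀ ∧ ∀ r : ℝ, 0 < r → r < r₀ →
      ∃ 𝒰 : CoverSeq Z (Fin (n + 1)), ∀ X : HypApprox Z r, 𝒰.Adapted X := by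
  obtain ⟨δ, hδ, τ₀, hτ₀, hcov⟩ := h
  refine ⟨min (1 / 24) (min τ₀ (δ / 28)), by positivity, fun r hr hr₀ => ?_⟩
  have hr1 : r < 1 / 24 := hr₀.trans_le (min_le_left _ _)
  have hr2 : r < τ₀ := hr₀.trans_le ((min_le_right _ _).trans (min_le_left _ _))
  have hr3 : r < δ / 28 := hr₀.trans_le ((min_le_right _ _).trans (min_le_right _ _))
  have hex : ∀ j : ℕ, ∃ W : Fin (n + 1) → Set (Set Z), (∀ c, ∀ V ∈ W c, IsOpen V) ∧
      (∀ c, ∀ V ∈ W c, V.Nonempty) ∧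
      (∀ c, ∀ V ∈ W c, ∀ x ∈ V, ∀ y ∈ V, dist x y ≤ r ^ j / 2) ∧
      (∀ c, ∀ V ∈ W c, ∀ V' ∈ W c, V ≠ V' → ∀ x ∈ V, ∀ y ∈ V',
        12 * r ^ (j + 1) < dist x y) ∧
      (j ≠ 0 → ∀ z, ∃ c, ∃ V ∈ W c, Metric.ball z (2 * r ^ (j + 1)) ⊆ V) := by
    intro j
    rcases eq_or_ne j 0 with rfl | hj
    -- Index 0 is a dummy: the covering there is `Z` itself, and saturations at `j ≥ 1` only use
    -- larger indices.
    · exact ⟨fun _ => ∅, by simp⟩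
    · have hle : r ^ j ≤ r := pow_le_of_le_one hr.le (by linarith) hj
      have hp := pow_pos hr j
      obtain ⟨𝒰, h1, h2, h3⟩ := hcov (r ^ j / 2) (by positivity) (by linarith)
      obtain ⟨W, hW1, hW2, hW3, hW4, hW5⟩ :=
        exists_core_families hr (by linarith) h1 h2 h3
      exact ⟨W, hW1, hW2, hW3, hW4, fun _ => hW5⟩
  choose W hopen hne hdist hgap hball using hex
  have hWS : ∀ c, WellSpaced (fun j => W j c) r := fun c =>
    ⟨hr, hr1.le, fun i => hdist i c, fun i => hgap i c⟩
  let F : ℕ → Fin (n + 1) → Set (Set Z) := fun j c =>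
    if j = 0 then {Set.univ} else saturation (fun j => W j c) r j '' W j c
  have hF0 : ∀ c, F 0 c = {Set.univ} := fun c => if_pos rfl
  have hF : ∀ j, j ≠ 0 → ∀ c, F j c = saturation (fun j => W j c) r j '' W j c :=
    fun j hj c => if_neg hj
  have hFball : ∀ j z, ∃ c, ∃ U ∈ F j c, Metric.ball z (2 * r ^ (j + 1)) ⊆ U := by
    intro j z
    rcases eq_or_ne j 0 with rfl | hj
    · exact ⟨0, Set.univ, by rw [hF0]; rfl, Set.subset_univ _⟩
    · obtain ⟨c, V, hV, hzV⟩ := hball j hj z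
      refine ⟨c, saturation (fun j => W j c) r j V, ?_, hzV.trans (subset_saturation j V)⟩
      rw [hF j hj]
      exact ⟨V, hV, rfl⟩
  refine ⟨⟨F, fun j => ⟨fun c U hU => ?_, fun c U hU U' hU' hne' => ?_, fun z => ?_⟩,
    fun j c U hU => ?_, hF0⟩, fun X => ⟨fun j hj => ?_, fun j v hv => ?_, ?_⟩⟩
  · rcases eq_or_ne j 0 with rfl | hj
    · rw [hF0] at hU
      rw [Set.mem_singleton_iff.1 hU]
      exact isOpen_univ
    · rw [hF j hj] at hU
      obtain ⟨V, hV, rfl⟩ := hU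
      exact isOpen_saturation (hopen j c V hV)
  · rcases eq_or_ne j 0 with rfl | hj
    · rw [hF0] at hU hU'
      exact absurd (hU.trans hU'.symm) hne'
    · rw [hF j hj] at hU hU'
      obtain ⟨V, hV, rfl⟩ := hU
      obtain ⟨V', hV', rfl⟩ := hU'
      exact (hWS c).disjoint_saturation hV hV' fun h => hne' (by rw [h])
  · obtain ⟨c, U, hU, hz⟩ := hFball j z
    exact ⟨c, U, hU, hz (Metric.mem_ball_self (by positivity))⟩
  · rcases eq_or_ne j 0 with rfl | hj
    · rw [hF0] at hU
      rw [Set.mem_singleton_iff.1 hU]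
      exact Set.univ_nonempty
    · rw [hF j hj] at hU
      obtain ⟨V, hV, rfl⟩ := hU
      exact (hne j c V hV).mono (subset_saturation j V)
  · have hj0 : j ≠ 0 := by omega
    have hp := pow_pos hr j
    have hp' := pow_pos hr (j + 1)
    have hlt : r ^ j / 2 + 2 * r ^ (j + 1) < r ^ j := by
      rw [pow_succ]
      nlinarith
    refine lt_of_le_of_lt ?_ ((ENNReal.ofReal_lt_ofReal_iff hp).2 hlt)
    refine iSup_le fun c => iSup₂_le fun U hU => Metric.ediam_le fun x hx y hy => ?_
    change U ∈ F j c at hU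
    rw [hF j hj0] at hU
    obtain ⟨V, hV, rfl⟩ := hU
    rw [edist_dist]
    exact ENNReal.ofReal_le_ofReal ((hWS c).dist_saturation_le hV hx hy)
  · have hrv : r ^ v.level = r ^ (j + 1) := by
      rw [hv]; exact_mod_cast zpow_natCast r (j + 1)
    rw [HypApprox.Vertex.ball, hrv]
    exact hFball j v.center
  · intro c j j' hjj' U hU U' hU' hne'
    change U ∈ F j c at hU
    change U' ∈ F j' c at hU'
    rcases eq_or_ne j' 0 with rfl | hj'
    · rw [hF0] at hU'
      rw [Set.mem_singleton_iff.1 hU']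
      exact .inl (Set.subset_univ _)
    · rw [hF j' hj'] at hU'
      rw [hF j (by omega)] at hU
      obtain ⟨V, hV, rfl⟩ := hU
      obtain ⟨V', hV', rfl⟩ := hU'
      have hhull := (hWS c).hull_saturation_subset X j V
      rcases hjj'.eq_or_lt with rfl | hlt
      · exact .inr (((hWS c).disjoint_thickening_saturation hV hV'
          fun h => hne' (by rw [h])).mono_left hhull)
      -- A neighborhood of index `j > j'` that meets the saturation is itself a link, so it is
      -- absorbed whole.
      · by_cases hmeet : (Metric.thickening (5 * r ^ (j + 1)) V ∩
            saturation (fun j => W j c) r j' V').Nonempty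
        · exact .inl (hhull.trans
            (thickening_subset_saturation (W := fun j => W j c) hlt hV hmeet))
        · exact .inr ((Set.disjoint_iff_inter_eq_empty.2
            (Set.not_nonempty_iff_eq_empty.1 hmeet)).mono_left hhull)

end Existence

end ColoredTrees

namespace ColoredTrees

/-! ### Geometry of hyperbolic approximations -/

namespace HypApprox

variable {Z : Type*} [MetricSpace Z] {r : ℝ} {X : HypApprox Z r}

lemma Vertex.ext {v w : X.Vertex} (h : v.level = w.level) (h' : v.center = w.center) : v = w :=
  Subtype.ext (Prod.ext h h')

lemma Vertex.k₀_le (v : X.Vertex) : X.k₀ ≤ v.level := v.2.1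

lemma Vertex.radius_pos (v : X.Vertex) : 0 < r ^ v.level := zpow_pos X.pos _

lemma Vertex.center_mem_ball (v : X.Vertex) : v.center ∈ v.ball :=
  Metric.mem_ball_self (by linarith [v.radius_pos])

lemma exists_vertex_near (X : HypApprox Z r) {k : ℤ} (hk : X.k₀ ≤ k) (z : Z) :
    ∃ v : X.Vertex, v.level = k ∧ dist z v.center < r ^ k := by
  by_contra! hcon
  have hfar : ∀ y ∈ X.V k, r ^ k ≤ dist z y := fun y hy => hcon ⟨(k, y), hk, hy⟩ rfl
  have hsep : IsSeparatedBy (r ^ k) (insert z (X.V k)) := by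
    refine (X.maximal k hk).prop.insert fun y hy _ => ⟨hfar y hy, ?_⟩
    rw [dist_comm]
    exact hfar y hy
  have hz : z ∈ X.V k :=
    (X.maximal k hk).le_of_ge hsep (Set.subset_insert _ _) (Set.mem_insert _ _)
  have := hfar z hz
  rw [dist_self] at this
  exact absurd (zpow_pos X.pos k) (not_lt.2 this)

lemma Vertex.eq_of_dist_lt {v w : X.Vertex} (h : v.level = w.level)
    (hd : dist v.center w.center < r ^ w.level) : v = w := by
  refine Vertex.ext h ?_
  by_contra hne
  have hv : v.center ∈ X.V w.level := h ▸ v.2.2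
  have hw : w.center ∈ X.V w.level := w.2.2
  have hsep := (X.maximal _ w.k₀_le).prop hv hw hne
  exact absurd hd (not_lt.2 hsep)

lemma Vertex.eq_of_level_eq_k₀ [BoundedSpace Z] {v w : X.Vertex} (hv : v.level = X.k₀)
    (hw : w.level = X.k₀) : v = w := by
  refine Vertex.eq_of_dist_lt (hv.trans hw.symm) ?_
  rw [hw]
  exact (Metric.dist_le_diam_of_mem (Bornology.IsBounded.all _) (Set.mem_univ _)
    (Set.mem_univ _)).trans_lt X.isGreatest.1

lemma Horizontal.symm {v w : X.Vertex} (h : Horizontal v w) : Horizontal w v :=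
  ⟨h.1.symm, h.2.1.symm, by rw [Set.inter_comm]; exact h.2.2⟩

lemma Horizontal.adj {v w : X.Vertex} (h : Horizontal v w) : X.graph.Adj v w := Or.inl h

lemma Radial.adj {v w : X.Vertex} (h : Radial v w) : X.graph.Adj v w := Or.inr (Or.inl h)

lemma Horizontal.k₀_lt [BoundedSpace Z] {v w : X.Vertex} (h : Horizontal v w) :
    X.k₀ < v.level :=
  lt_of_le_of_ne v.k₀_le fun hv => h.1 (Vertex.eq_of_level_eq_k₀ hv.symm (h.2.1 ▸ hv.symm))

lemma Horizontal.dist_le {v w : X.Vertex} (h : Horizontal v w) :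
    dist w.center v.center ≤ 4 * r ^ v.level := by
  obtain ⟨-, hl, z, hv, hw⟩ := h
  rw [Vertex.closedBall, Metric.mem_closedBall] at hv hw
  rw [← hl, dist_comm] at hw
  linarith [dist_triangle w.center z v.center]

/-- Here `r ≤ 1 / 6` enters: `r ^ k + (4 + 2) * r ^ (k + 1) ≤ 2 * r ^ k`. The slack 4 covers a
horizontal neighbor. -/
lemma radial_of_dist_le {u v : X.Vertex} (hl : v.level = u.level + 1)
    (hd : dist v.center u.center ≤ r ^ u.level + 4 * r ^ v.level) : Radial u v := by
  refine ⟨hl, Metric.ball_subset_ball' ?_⟩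
  have h1 : r ^ v.level ≤ r ^ u.level / 6 := by
    rw [hl, zpow_add_one₀ X.pos.ne']
    nlinarith [u.radius_pos, X.le_sixth]
  linarith

/-- A vertex below the root level has a parent which is also a parent of all its neighbors of the
same level. -/
lemma Vertex.exists_parent {v : X.Vertex} (hv : X.k₀ < v.level) :
    ∃ u, Radial u v ∧ ∀ w, Horizontal v w → Radial u w := by
  obtain ⟨u, hu, hd⟩ := X.exists_vertex_near (k := v.level - 1) (by omega) v.center
  rw [← hu] at hd
  refine ⟨u, radial_of_dist_le (by omega) (by linarith [v.radius_pos]), fun w hw => ?_⟩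
  refine radial_of_dist_le (by have := hw.2.1; omega) ?_
  rw [← hw.2.1]
  linarith [hw.dist_le, dist_triangle w.center v.center u.center]

lemma horizontal_of_mem_ball {u u' : X.Vertex} (hl : u.level = u'.level) {z : Z}
    (hz : z ∈ u.ball) (hz' : z ∈ u'.ball) : u = u' ∨ Horizontal u u' :=
  (eq_or_ne u u').imp_right fun hne =>
    ⟨hne, hl, z, Metric.ball_subset_closedBall hz, Metric.ball_subset_closedBall hz'⟩

lemma Radial.eq_or_horizontal {u u' v : X.Vertex} (h : Radial u v) (h' : Radial u' v) :
    u = u' ∨ Horizontal u u' :=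
  horizontal_of_mem_ball (by have := h.1; have := h'.1; omega) (h.2 v.center_mem_ball)
    (h'.2 v.center_mem_ball)

/-! ### Descending paths and normal forms of paths -/

/-- `Descends a v x`: going from `v` to parents `a` times, one may arrive at `x`. -/
inductive Descends : ℕ → X.Vertex → X.Vertex → Prop
  | refl (v : X.Vertex) : Descends 0 v v
  | cons {a : ℕ} {v u x : X.Vertex} (h : Radial u v) (t : Descends a u x) : Descends (a + 1) v x

lemma Descends.snoc {a : ℕ} {v x y : X.Vertex} (h : Descends a v x) (hy : Radial y x) :
    Descends (a + 1) v y := by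
  induction h with
  | refl v => exact .cons hy (.refl _)
  | cons h _ ih => exact .cons h (ih hy)

lemma Descends.ball_subset {a : ℕ} {v x : X.Vertex} (h : Descends a v x) : v.ball ⊆ x.ball := by
  induction h with
  | refl v => exact subset_rfl
  | cons h _ ih => exact h.2.trans ih

lemma Descends.exists_walk {a : ℕ} {v x : X.Vertex} (h : Descends a v x) :
    ∃ p : X.graph.Walk v x, p.length = a := by
  induction h with
  | refl v => exact ⟨.nil, rfl⟩
  | cons h _ ih =>
    obtain ⟨p, hp⟩ := ih
    exact ⟨.cons h.adj.symm p, by rw [SimpleGraph.Walk.length_cons, hp]⟩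

/-- The intermediate vertices are all chosen close to the center of `v`, so consecutive ones are
close enough to be radially adjacent. -/
lemma Descends.of_dist_lt {a : ℕ} {v : X.Vertex} : ∀ {u : X.Vertex}, v.level = u.level + a →
    dist v.center u.center < r ^ u.level → Descends a v u := by
  induction a with
  | zero =>
    intro u hl hd
    obtain rfl := Vertex.eq_of_dist_lt (by simpa using hl) hd
    exact .refl _
  | succ a ih =>
    intro u hl hd
    have hu := u.k₀_le
    obtain ⟨w, hw, hdw⟩ := X.exists_vertex_near (k := u.level + 1) (by omega) v.center
    rw [← hw] at hdw
    refine (ih (by push_cast at hl; omega) hdw).snoc (radial_of_dist_le hw ?_)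
    have h1 := dist_triangle w.center v.center u.center
    rw [dist_comm w.center v.center] at h1
    linarith [w.radius_pos]

lemma Vertex.exists_descends (v : X.Vertex) {k : ℤ} (hk : X.k₀ ≤ k) (hkv : k ≤ v.level) :
    ∃ u : X.Vertex, u.level = k ∧ dist v.center u.center < r ^ k ∧
      Descends (v.level - k).toNat v u := by
  obtain ⟨u, hu, hd⟩ := X.exists_vertex_near hk v.center
  exact ⟨u, hu, hd, .of_dist_lt (by omega) (by rwa [hu])⟩

lemma graph_connected [BoundedSpace Z] [Nonempty Z] : X.graph.Connected := by
  obtain ⟨o, ho, -⟩ := X.exists_vertex_near le_rfl (Classical.arbitrary Z)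
  have hroot : ∀ v : X.Vertex, X.graph.Reachable v o := by
    intro v
    obtain ⟨u, hu, -, hvu⟩ := v.exists_descends le_rfl v.k₀_le
    obtain rfl := Vertex.eq_of_level_eq_k₀ hu ho
    obtain ⟨p, -⟩ := hvu.exists_walk
    exact ⟨p⟩
  exact { preconnected := fun v w => (hroot v).trans (hroot w).symm, nonempty := ⟨o⟩ }

lemma graph_dist_le {v w : X.Vertex} {k : ℤ} (hk : X.k₀ ≤ k) (hkv : k ≤ v.level)
    (hkw : k ≤ w.level) (hd : dist v.center w.center ≤ r ^ k) :
    (X.graph.dist v w : ℤ) ≤ v.level + w.level - 2 * k + 1 := by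
  obtain ⟨x, hx, hdx, hvx⟩ := v.exists_descends hk hkv
  obtain ⟨y, hy, hdy, hwy⟩ := w.exists_descends hk hkw
  obtain ⟨p, hp⟩ := hvx.exists_walk
  obtain ⟨q, hq⟩ := hwy.exists_walk
  have hpos : 0 < r ^ k := zpow_pos X.pos k
  have hmem : v.center ∈ x.ball := by
    rw [Vertex.ball, Metric.mem_ball, hx]
    linarith
  have hmem' : v.center ∈ y.ball := by
    rw [Vertex.ball, Metric.mem_ball, hy]
    linarith [dist_triangle v.center w.center y.center]
  rcases horizontal_of_mem_ball (hx.trans hy.symm) hmem hmem' with rfl | hxy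
  · have := SimpleGraph.dist_le (p.append q.reverse)
    rw [SimpleGraph.Walk.length_append, SimpleGraph.Walk.length_reverse, hp, hq] at this
    omega
  · have := SimpleGraph.dist_le (p.append (.cons hxy.adj q.reverse))
    rw [SimpleGraph.Walk.length_append, SimpleGraph.Walk.length_cons,
      SimpleGraph.Walk.length_reverse, hp, hq] at this
    omega

/-- Two vertices are joined by a path of length `N` that first goes through parents, then uses at
most one edge between vertices of equal level, and then goes through children. -/
def Joined (v w : X.Vertex) (N : ℕ) : Prop :=
  ∃ a b x y, Descends a v x ∧ Descends b w y ∧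
    ((x = y ∧ a + b = N) ∨ (Horizontal x y ∧ a + b + 1 = N))

lemma Joined.ascend {v w w' : X.Vertex} {N : ℕ} (h : Joined v w N) (hw : Radial w w') :
    Joined v w' (N + 1) := by
  obtain ⟨a, b, x, y, hv, hy, h⟩ := h
  exact ⟨a, b + 1, x, y, hv, .cons hw hy,
    h.imp (fun h => ⟨h.1, by omega⟩) fun h => ⟨h.1, by omega⟩⟩

/-- The new horizontal edge is pushed down the descent from `w`: parents of its two ends coincide or
are again horizontal neighbors. If it reaches an existing horizontal edge, a common parent of all
three ends replaces both. -/
lemma Joined.horizontal [BoundedSpace Z] {v w w' : X.Vertex} {N : ℕ} (h : Joined v w N)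
    (hw : Horizontal w w') : ∃ N' ≤ N + 1, Joined v w' N' := by
  obtain ⟨a, b, x, y, hv, hy, h⟩ := h
  induction hy generalizing N w' with
  | refl y =>
    rcases h with ⟨rfl, rfl⟩ | ⟨hxy, rfl⟩
    · exact ⟨a + 1, by omega, a, 0, x, w', hv, .refl _, .inr ⟨hw, by omega⟩⟩
    · obtain ⟨u, -, hu⟩ := Vertex.exists_parent hw.k₀_lt
      exact ⟨a + 2, by omega, a + 1, 1, u, u, hv.snoc (hu _ hxy.symm),
        .cons (hu _ hw) (.refl _), .inl ⟨rfl, rfl⟩⟩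
  | @cons b w u y hu ht ih =>
    obtain ⟨u', hu', hall⟩ := Vertex.exists_parent hw.symm.k₀_lt
    rcases hu.eq_or_horizontal (hall _ hw.symm) with rfl | huu'
    · exact ⟨N, by omega, a, b + 1, x, y, hv, .cons hu' ht, h⟩
    · obtain ⟨N', hN', hj⟩ := ih (N := N - 1) huu'
        (h.imp (fun h => ⟨h.1, by omega⟩) fun h => ⟨h.1, by omega⟩)
      exact ⟨N' + 1, by omega, hj.ascend hu'⟩

lemma Joined.descend [BoundedSpace Z] {v w w' : X.Vertex} {N : ℕ} (h : Joined v w N)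
    (hw : Radial w' w) : ∃ N' ≤ N + 1, Joined v w' N' := by
  obtain ⟨a, b, x, y, hv, hy, h⟩ := h
  cases hy with
  | refl =>
    rcases h with ⟨rfl, rfl⟩ | ⟨hxw, rfl⟩
    · exact ⟨a + 1, by omega, a + 1, 0, w', w', hv.snoc hw, .refl _, .inl ⟨rfl, rfl⟩⟩
    · obtain ⟨u, hu, hall⟩ := Vertex.exists_parent hxw.k₀_lt
      rcases (hall _ hxw).eq_or_horizontal hw with rfl | huw'
      · exact ⟨a + 1, by omega, a + 1, 0, u, u, hv.snoc hu, .refl _, .inl ⟨rfl, rfl⟩⟩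
      · exact ⟨a + 2, by omega, a + 1, 0, u, w', hv.snoc hu, .refl _, .inr ⟨huw', rfl⟩⟩
  | @cons b _ u _ hu ht =>
    rcases hu.eq_or_horizontal hw with rfl | huw'
    · exact ⟨N - 1, by omega, a, b, x, y, hv, ht,
        h.imp (fun h => ⟨h.1, by omega⟩) fun h => ⟨h.1, by omega⟩⟩
    · obtain ⟨N', hN', hj⟩ :=
        Joined.horizontal (N := N - 1) ⟨a, b, x, y, hv, ht,
          h.imp (fun h => ⟨h.1, by omega⟩) fun h => ⟨h.1, by omega⟩⟩ huw'
      exact ⟨N', by omega, hj⟩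

lemma exists_joined [BoundedSpace Z] {v w : X.Vertex} (p : X.graph.Walk w v) :
    ∃ N ≤ p.length, Joined v w N := by
  induction p with
  | nil => exact ⟨0, le_rfl, 0, 0, _, _, .refl _, .refl _, .inl ⟨rfl, rfl⟩⟩
  | cons h p ih =>
    obtain ⟨N, hN, hj⟩ := ih
    rw [SimpleGraph.Walk.length_cons]
    rcases h with h | h | h
    · obtain ⟨N', hN', hj'⟩ := hj.horizontal h.symm
      exact ⟨N', by omega, hj'⟩
    · obtain ⟨N', hN', hj'⟩ := hj.descend h
      exact ⟨N', by omega, hj'⟩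
    · exact ⟨N + 1, by omega, hj.ascend h⟩

/-- Guarantees that vertices exist at every level `j + 1`, `j ≥ 0`, as the hulls require. -/
lemma k₀_nonpos (h : r < Metric.diam (Set.univ : Set Z)) : X.k₀ ≤ 0 := by
  by_contra! hcon
  have h1 : r ^ X.k₀ ≤ r ^ (1 : ℤ) :=
    zpow_le_zpow_right_of_le_one₀ X.pos (by linarith [X.le_sixth]) (by omega)
  rw [zpow_one] at h1
  have h2 : Metric.diam (Set.univ : Set Z) < r ^ X.k₀ := X.isGreatest.1
  linarith

/-- Keeps the additive constant of the lower bound universal: at most one level lies below 0. -/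
lemma neg_one_le_k₀ (h : r < Metric.diam (Set.univ : Set Z))
    (h' : r < 1 / Metric.diam (Set.univ : Set Z)) : -1 ≤ X.k₀ := by
  refine X.isGreatest.2 ?_
  change Metric.diam (Set.univ : Set Z) < r ^ (-1 : ℤ)
  rw [zpow_neg_one, ← one_div]
  exact (lt_one_div X.pos (X.pos.trans h)).1 h'

end HypApprox

end ColoredTrees

namespace ColoredTrees

/-! ### Colored trees -/

namespace CoverSeq

open HypApprox

variable {Z C : Type*} [MetricSpace Z] {𝒰 : CoverSeq Z C} {c : C} {r : ℝ} {X : HypApprox Z r}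

lemma TreeVertex.ext {u w : 𝒰.TreeVertex c} (h : u.level = w.level) (h' : u.set = w.set) :
    u = w :=
  Subtype.ext (Prod.ext h h')

lemma TreeVertex.mem (u : 𝒰.TreeVertex c) : u.set ∈ 𝒰.family u.level c := u.2

lemma TreeVertex.set_nonempty (u : 𝒰.TreeVertex c) : u.set.Nonempty :=
  𝒰.nonempty _ _ _ u.mem

lemma TreeVertex.eq_of_inter_nonempty {u w : 𝒰.TreeVertex c} (h : u.level = w.level)
    (h' : (u.set ∩ w.set).Nonempty) : u = w := by
  refine TreeVertex.ext h ?_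
  by_contra hne
  exact Set.not_disjoint_iff_nonempty_inter.2 h'
    ((𝒰.isCover w.level).disjoint c (h ▸ u.mem) w.mem hne)

variable (𝒰 c) in
/-- The root of `T_c`. -/
def root : 𝒰.TreeVertex c := ⟨(0, Set.univ), by rw [𝒰.zero]; rfl⟩

lemma TreeVertex.eq_root {u : 𝒰.TreeVertex c} (h : u.level = 0) : u = 𝒰.root c :=
  TreeVertex.eq_of_inter_nonempty h (by simpa [root, TreeVertex.set] using u.set_nonempty)

lemma IsAncestor.trans {a b u : 𝒰.TreeVertex c} (h : IsAncestor a b) (h' : IsAncestor b u) :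
    IsAncestor a u :=
  ⟨h.1.trans h'.1, h'.2.trans h.2⟩

lemma TreeVertex.exists_parent {u : 𝒰.TreeVertex c} (h : u.level ≠ 0) : ∃ p, IsParent p u := by
  classical
  let P : ℕ → Prop := fun m => ∃ a : 𝒰.TreeVertex c, IsAncestor a u ∧ a.level = m
  have h0 : P 0 := ⟨𝒰.root c, ⟨Nat.pos_of_ne_zero h, Set.subset_univ _⟩, rfl⟩
  obtain ⟨p, hp, hl⟩ := Nat.findGreatest_spec (P := P) (Nat.zero_le u.level) h0
  refine ⟨p, hp, fun b hb => ?_⟩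
  rw [hl]
  exact Nat.le_findGreatest hb.1.le ⟨b, hb, rfl⟩

/-- The ancestors of `u` together with `u` itself. -/
def ancestors (u : 𝒰.TreeVertex c) : Set (𝒰.TreeVertex c) := {a | a = u ∨ IsAncestor a u}

lemma level_le_of_mem_ancestors {a u : 𝒰.TreeVertex c} (h : a ∈ ancestors u) :
    a.level ≤ u.level := by
  rcases h with rfl | h
  · exact le_rfl
  · exact h.1.le

lemma set_subset_of_mem_ancestors {a u : 𝒰.TreeVertex c} (h : a ∈ ancestors u) :
    u.set ⊆ a.set := by
  rcases h with rfl | h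
  · exact subset_rfl
  · exact h.2

lemma IsParent.adj {p u : 𝒰.TreeVertex c} (h : IsParent p u) : (𝒰.tree c).Adj p u := Or.inl h

lemma IsParent.unique {p q u : 𝒰.TreeVertex c} (hp : IsParent p u) (hq : IsParent q u) :
    p = q := by
  obtain ⟨z, hz⟩ := u.set_nonempty
  exact TreeVertex.eq_of_inter_nonempty (le_antisymm (hq.2 p hp.1) (hp.2 q hq.1))
    ⟨z, hp.1.2 hz, hq.1.2 hz⟩

lemma tree_connected : (𝒰.tree c).Connected := by
  have hroot : ∀ (m : ℕ) (u : 𝒰.TreeVertex c), u.level = m →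
      (𝒰.tree c).Reachable u (𝒰.root c) := by
    intro m
    induction m using Nat.strong_induction_on with
    | _ m ih =>
      intro u hu
      rcases eq_or_ne m 0 with rfl | hm
      · rw [TreeVertex.eq_root hu]
      · obtain ⟨p, hp⟩ := TreeVertex.exists_parent (hu ▸ hm)
        exact hp.adj.symm.reachable.trans (ih p.level (hu ▸ hp.1.1) p rfl)
  exact { preconnected := fun v w => (hroot _ v rfl).trans (hroot _ w rfl).symm
          nonempty := ⟨𝒰.root c⟩ }

lemma subset_hull (hk : X.k₀ ≤ 0) (j : ℕ) (U : Set Z) : U ⊆ hull X j U := by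
  intro z hz
  obtain ⟨v, hv, hd⟩ := X.exists_vertex_near (k := (j : ℤ) + 1) (by omega) z
  have hzv : z ∈ v.ball := by
    rw [Vertex.ball, Metric.mem_ball, hv]
    have := hv ▸ v.radius_pos
    linarith
  exact Set.mem_iUnion₂.2 ⟨v, ⟨hv, z, hzv, hz⟩, hzv⟩

namespace Adapted

lemma hull_subset (h : 𝒰.Adapted X) {a u : 𝒰.TreeVertex c}
    (hl : a.level ≤ u.level) (hne : u ≠ a) (hm : (hull X u.level u.set ∩ a.set).Nonempty) :
    hull X u.level u.set ⊆ a.set := by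
  refine (h.separation c _ _ hl _ u.mem _ a.mem fun heq => hne (Subtype.ext heq)).resolve_right ?_
  exact Set.not_disjoint_iff_nonempty_inter.2 hm

/-- The hull of `u` contains `u`, hence meets `a`, and separation leaves only containment. -/
lemma isAncestor (h : 𝒰.Adapted X) (hk : X.k₀ ≤ 0) {a u : 𝒰.TreeVertex c}
    (hl : a.level < u.level) (hm : (u.set ∩ a.set).Nonempty) : IsAncestor a u := by
  refine ⟨hl, (subset_hull hk _ _).trans (h.hull_subset hl.le ?_ ?_)⟩
  · rintro rfl
    exact lt_irrefl _ hl
  · exact hm.mono (Set.inter_subset_inter_left _ (subset_hull hk _ _))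

lemma hull_subset_of_isAncestor (h : 𝒰.Adapted X) (hk : X.k₀ ≤ 0) {a u : 𝒰.TreeVertex c}
    (ha : IsAncestor a u) : hull X u.level u.set ⊆ a.set := by
  refine h.hull_subset ha.1.le ?_ ?_
  · rintro rfl
    exact lt_irrefl _ ha.1
  · obtain ⟨z, hz⟩ := u.set_nonempty
    exact ⟨z, subset_hull hk _ _ hz, ha.2 hz⟩

lemma mem_ancestors (h : 𝒰.Adapted X) (hk : X.k₀ ≤ 0) {a u : 𝒰.TreeVertex c}
    (hl : a.level ≤ u.level) (hm : (u.set ∩ a.set).Nonempty) : a ∈ ancestors u := by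
  rcases hl.eq_or_lt with hl | hl
  · exact .inl (TreeVertex.eq_of_inter_nonempty hl (by rwa [Set.inter_comm]))
  · exact .inr (h.isAncestor hk hl hm)

lemma mem_ancestors_iff (h : 𝒰.Adapted X) (hk : X.k₀ ≤ 0) {a p u : 𝒰.TreeVertex c}
    (hp : IsParent p u) : a ∈ ancestors u ↔ a = u ∨ a ∈ ancestors p := by
  refine or_congr_right ⟨fun ha => ?_, ?_⟩
  · obtain ⟨z, hz⟩ := u.set_nonempty
    exact h.mem_ancestors hk (hp.2 a ha) ⟨z, hp.1.2 hz, ha.2 hz⟩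
  · rintro (rfl | ha)
    · exact hp.1
    · exact ha.trans hp.1

lemma isTree (h : 𝒰.Adapted X) (hk : X.k₀ ≤ 0) (c : C) : (𝒰.tree c).IsTree := by
  refine ⟨tree_connected, SimpleGraph.isAcyclic_iff_forall_adj_isBridge.2 ?_⟩
  have key : ∀ p u : 𝒰.TreeVertex c, IsParent p u → (𝒰.tree c).IsBridge s(p, u) := by
    intro p u hp
    rw [SimpleGraph.isBridge_iff]
    -- Being `u` or a descendant of `u` can change only across the edge from `u` to its parent, so
    -- without that edge no walk reaches `u` from `p`.
    rintro ⟨q⟩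
    have hstep : ∀ x y, ((𝒰.tree c).deleteEdges {s(p, u)}).Walk x y →
        u ∉ ancestors x → u ∉ ancestors y := by
      intro x y q
      induction q with
      | nil => exact id
      | @cons x y _ hxy _ ih =>
        refine fun hx => ih fun hy => ?_
        obtain ⟨hadj, hne⟩ := SimpleGraph.deleteEdges_adj.1 hxy
        rcases hadj with hp' | hp'
        · rcases (h.mem_ancestors_iff hk hp').1 hy with rfl | hy
          · exact hne (by rw [hp'.unique hp]; rfl)
          · exact hx hy
        · exact hx ((h.mem_ancestors_iff hk hp').2 (.inr hy))
    refine hstep p u q (fun hu => ?_) (.inl rfl)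
    exact absurd (level_le_of_mem_ancestors hu) (not_le.2 hp.1.1)
  rintro u w (huw | huw)
  · exact key u w huw
  · rw [Sym2.eq_swap]
    exact key w u huw

lemma encard_symmDiff_le (h : 𝒰.Adapted X) (hk : X.k₀ ≤ 0) {u w : 𝒰.TreeVertex c}
    (q : (𝒰.tree c).Walk u w) :
    (symmDiff (ancestors u) (ancestors w)).encard ≤ q.length := by
  have key : ∀ p u : 𝒰.TreeVertex c, IsParent p u →
      (symmDiff (ancestors p) (ancestors u)).encard ≤ 1 := by
    intro p u hp
    refine (Set.encard_le_encard (t := {u}) fun a ha => ?_).trans (Set.encard_singleton u).le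
    have := h.mem_ancestors_iff hk (a := a) hp
    rcases ha with ha | ha
    · exact absurd (this.2 (.inr ha.1)) ha.2
    · exact (this.1 ha.1).resolve_right ha.2
  induction q with
  | nil => simp
  | @cons u x w hux q ih =>
    have h1 : (symmDiff (ancestors u) (ancestors x)).encard ≤ 1 := by
      rcases hux with hux | hux
      · exact key _ _ hux
      · rw [symmDiff_comm]
        exact key _ _ hux
    refine (Set.encard_le_encard (symmDiff_triangle _ (ancestors x) _)).trans
      ((Set.encard_union_le _ _).trans ?_)
    rw [SimpleGraph.Walk.length_cons, add_comm q.length]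
    push_cast
    exact add_le_add h1 ih

lemma card_add_card_le_dist (h : 𝒰.Adapted X) (hk : X.k₀ ≤ 0) {u w : 𝒰.TreeVertex c}
    {J J' : Finset ℕ}
    (hJ : ∀ j ∈ J, ∃ a ∈ ancestors u, a ∉ ancestors w ∧ a.level = j)
    (hJ' : ∀ j ∈ J', ∃ a ∈ ancestors w, a ∉ ancestors u ∧ a.level = j) :
    J.card + J'.card ≤ (𝒰.tree c).dist u w := by
  have himage : ∀ (S : Set (𝒰.TreeVertex c)) (J : Finset ℕ),
      (∀ j ∈ J, ∃ a ∈ S, a.level = j) → (J.card : ℕ∞) ≤ S.encard := by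
    intro S J hS
    rw [← Set.encard_coe_eq_coe_finsetCard]
    refine (Set.encard_le_encard fun j hj => ?_).trans (Set.encard_image_le TreeVertex.level S)
    obtain ⟨a, ha, hl⟩ := hS j hj
    exact ⟨a, ha, hl⟩
  obtain ⟨q, hq⟩ := (tree_connected (𝒰 := 𝒰) (c := c)).exists_walk_length_eq_dist u w
  have h1 := himage (ancestors u \ ancestors w) J fun j hj =>
    let ⟨a, h1, h2, h3⟩ := hJ j hj; ⟨a, ⟨h1, h2⟩, h3⟩
  have h2 := himage (ancestors w \ ancestors u) J' fun j hj =>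
    let ⟨a, h1, h2, h3⟩ := hJ' j hj; ⟨a, ⟨h1, h2⟩, h3⟩
  have h3 := h.encard_symmDiff_le hk q
  rw [hq, Set.symmDiff_def, Set.encard_union_eq disjoint_sdiff_sdiff] at h3
  exact_mod_cast (add_le_add h1 h2).trans h3

end Adapted

/-! ### The maps into the colored trees -/

lemma ball_subset_treeMap (v : X.Vertex) : v.ball ⊆ (𝒰.treeMap c v).set :=
  (Classical.choose_spec (𝒰.mapLevel_spec c v)).2

lemma level_treeMap_le (v : X.Vertex) : (𝒰.treeMap c v).level ≤ (v.level - 1).toNat := by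
  classical
  exact Nat.findGreatest_le _

lemma le_level_treeMap {v : X.Vertex} {a : 𝒰.TreeVertex c} (ha : v.ball ⊆ a.set)
    (hl : a.level ≤ (v.level - 1).toNat) : a.level ≤ (𝒰.treeMap c v).level := by
  classical
  exact Nat.le_findGreatest hl ⟨a.set, a.mem, ha⟩

/-- The ball lies in a ball of level exactly `u.level + 1`, which then also meets `u`. -/
lemma ball_subset_hull (hk : X.k₀ ≤ 0) {v : X.Vertex} {u : 𝒰.TreeVertex c}
    (hm : (v.ball ∩ u.set).Nonempty) (hl : (u.level : ℤ) + 1 ≤ v.level) :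
    v.ball ⊆ hull X u.level u.set := by
  obtain ⟨x, hx, -, hvx⟩ := v.exists_descends (k := (u.level : ℤ) + 1) (by omega) hl
  exact hvx.ball_subset.trans (Set.subset_biUnion_of_mem (u := Vertex.ball)
    ⟨hx, hm.mono (Set.inter_subset_inter_left _ hvx.ball_subset)⟩)

namespace Adapted

lemma mem_ancestors_treeMap (h : 𝒰.Adapted X) (hk : X.k₀ ≤ 0) {v : X.Vertex}
    {a : 𝒰.TreeVertex c} (ha : v.ball ⊆ a.set) (hl : a.level ≤ (v.level - 1).toNat) :
    a ∈ ancestors (𝒰.treeMap c v) :=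
  h.mem_ancestors hk (le_level_treeMap ha hl)
    ⟨v.center, ball_subset_treeMap v v.center_mem_ball, ha v.center_mem_ball⟩

/-- Every ancestor of `u` contains the hull of `u`, hence `B(v)`, so the maximality in `f_c(v)`
leaves no ancestor of higher index. -/
lemma isParent_treeMap (h : 𝒰.Adapted X) (hk : X.k₀ ≤ 0) {v : X.Vertex} {u : 𝒰.TreeVertex c}
    (hm : (v.ball ∩ u.set).Nonempty) (hl : (u.level : ℤ) + 1 ≤ v.level)
    (hlt : (𝒰.treeMap c v).level < u.level) : IsParent (𝒰.treeMap c v) u := by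
  refine ⟨h.isAncestor hk hlt ?_, fun b hb => le_level_treeMap ?_ ?_⟩
  · rw [Set.inter_comm]
    exact hm.mono (Set.inter_subset_inter_left _ (ball_subset_treeMap v))
  · exact (ball_subset_hull hk hm hl).trans (h.hull_subset_of_isAncestor hk hb)
  · have := hb.1
    omega

lemma dist_le_one_of_inter_nonempty (h : 𝒰.Adapted X) (hk : X.k₀ ≤ 0) {v w : X.Vertex}
    (hl : v.level = w.level) (hm : (v.ball ∩ w.ball).Nonempty) :
    (𝒰.tree c).dist (𝒰.treeMap c v) (𝒰.treeMap c w) ≤ 1 := by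
  have key : ∀ v w : X.Vertex, v.level = w.level → (v.ball ∩ w.ball).Nonempty →
      (𝒰.treeMap c v).level < (𝒰.treeMap c w).level →
      (𝒰.tree c).dist (𝒰.treeMap c v) (𝒰.treeMap c w) ≤ 1 := by
    intro v w hl hm hlt
    have := level_treeMap_le (𝒰 := 𝒰) (c := c) w
    refine (SimpleGraph.dist_eq_one_iff_adj.2 (h.isParent_treeMap hk ?_ ?_ hlt).adj).le
    · exact hm.mono (Set.inter_subset_inter_right _ (ball_subset_treeMap w))
    · omega
  rcases lt_trichotomy (𝒰.treeMap c v).level (𝒰.treeMap c w).level with hlt | heq | hlt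
  · exact key v w hl hm hlt
  · rw [TreeVertex.eq_of_inter_nonempty heq
      (hm.mono (Set.inter_subset_inter (ball_subset_treeMap v) (ball_subset_treeMap w)))]
    simp
  · rw [SimpleGraph.dist_comm]
    exact key w v hl.symm (by rwa [Set.inter_comm]) hlt

/-- `B(v) ⊆ B(u)` makes `f_c(u)` an ancestor of `f_c(v)` or equal to it. Only one index is available
to `v` but possibly not to `u`; once `f_c(v)` of that index is replaced by its parent `q`,
`isParent_treeMap` applies to `u`. -/
lemma treeMap_of_radial (h : 𝒰.Adapted X) (hk : X.k₀ ≤ 0) {u v : X.Vertex} (huv : Radial u v)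
    (c : C) : 𝒰.treeMap c u = 𝒰.treeMap c v ∨ IsParent (𝒰.treeMap c u) (𝒰.treeMap c v) ∨
      ∃ q, IsParent (𝒰.treeMap c u) q ∧ IsParent q (𝒰.treeMap c v) ∧
        (q.level : ℤ) + 1 ≤ u.level := by
  have hv := level_treeMap_le (𝒰 := 𝒰) (c := c) v
  have hu := level_treeMap_le (𝒰 := 𝒰) (c := c) u
  have hl := huv.1
  have hanc : 𝒰.treeMap c u ∈ ancestors (𝒰.treeMap c v) :=
    h.mem_ancestors_treeMap hk (huv.2.trans (ball_subset_treeMap u)) (by omega)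
  have hmeet : ∀ q ∈ ancestors (𝒰.treeMap c v), (u.ball ∩ q.set).Nonempty := fun q hq =>
    ⟨v.center, huv.2 v.center_mem_ball,
      set_subset_of_mem_ancestors hq (ball_subset_treeMap v v.center_mem_ball)⟩
  rcases hanc with heq | hanc
  · exact .inl heq
  right
  have hlt := hanc.1
  by_cases hle : ((𝒰.treeMap c v).level : ℤ) + 1 ≤ u.level
  · exact .inl (h.isParent_treeMap hk (hmeet _ (.inl rfl)) hle hlt)
  obtain ⟨q, hq⟩ := TreeVertex.exists_parent (u := 𝒰.treeMap c v) (by omega)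
  have hq1 := hq.1.1
  rcases ((h.mem_ancestors_iff hk hq).1 (.inr hanc)) with heq | heq | hq'
  · rw [← heq] at hlt
    exact absurd hlt (lt_irrefl _)
  · exact .inl (heq ▸ hq)
  · exact .inr ⟨q, h.isParent_treeMap hk (hmeet q (.inr hq.1)) (by omega) hq'.1, hq, by omega⟩

lemma dist_le_two_of_radial (h : 𝒰.Adapted X) (hk : X.k₀ ≤ 0) {u v : X.Vertex}
    (huv : Radial u v) : (𝒰.tree c).dist (𝒰.treeMap c u) (𝒰.treeMap c v) ≤ 2 := by
  rcases h.treeMap_of_radial hk huv c with heq | hp | ⟨q, hq, hq', -⟩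
  · rw [heq]
    simp
  · rw [SimpleGraph.dist_eq_one_iff_adj.2 hp.adj]
    omega
  · exact SimpleGraph.dist_le (.cons hq.adj (.cons hq'.adj .nil))

lemma dist_le_two_of_adj (h : 𝒰.Adapted X) (hk : X.k₀ ≤ 0) {v w : X.Vertex}
    (hvw : X.graph.Adj v w) (hm : (v.ball ∩ w.ball).Nonempty) :
    (𝒰.tree c).dist (𝒰.treeMap c v) (𝒰.treeMap c w) ≤ 2 := by
  rcases hvw with hvw | hvw | hvw
  · exact (h.dist_le_one_of_inter_nonempty hk hvw.2.1 hm).trans one_le_two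
  · exact h.dist_le_two_of_radial hk hvw
  · rw [SimpleGraph.dist_comm]
    exact h.dist_le_two_of_radial hk hvw

/-- Two children of `f_c(u)` of small level that meet `B(u)` coincide. -/
lemma eq_of_isParent_treeMap (h : 𝒰.Adapted X) (hk : X.k₀ ≤ 0) {u : X.Vertex}
    {q q' : 𝒰.TreeVertex c} (hq : IsParent (𝒰.treeMap c u) q) (hq' : IsParent (𝒰.treeMap c u) q')
    (hl : (q.level : ℤ) + 1 ≤ u.level) (hl' : (q'.level : ℤ) + 1 ≤ u.level)
    (hm : (u.ball ∩ q.set).Nonempty) (hm' : (u.ball ∩ q'.set).Nonempty) : q = q' := by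
  have key : ∀ q q' : 𝒰.TreeVertex c, IsParent (𝒰.treeMap c u) q' →
      (q.level : ℤ) + 1 ≤ u.level → (q'.level : ℤ) + 1 ≤ u.level →
      (u.ball ∩ q.set).Nonempty → (u.ball ∩ q'.set).Nonempty → q'.level ≤ q.level → q = q' := by
    intro q q' hq' hl hl' hm hm' hle
    by_contra hne
    have hball := ball_subset_hull hk hm hl
    have hsub := h.hull_subset hle hne (hm'.mono (Set.inter_subset_inter_left _ hball))
    -- `B(u)` would lie in `q'`, a child of `f_c(u)`, against the maximality of the index of
    -- `f_c(u)`.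
    have := le_level_treeMap (hball.trans hsub) (by omega)
    have := hq'.1.1
    omega
  rcases le_total q'.level q.level with hle | hle
  · exact key q q' hq' hl hl' hm hm' hle
  · exact (key q' q hq hl' hl hm' hm hle).symm

/-- The open balls need not meet, so the route is through a common parent `u`. A bound of 4 would
follow at once; if both halves have two edges, their middle vertices coincide and the distance is at
most 2. -/
lemma dist_le_three_of_horizontal [BoundedSpace Z] (h : 𝒰.Adapted X) (hk : X.k₀ ≤ 0)
    {v w : X.Vertex} (hvw : Horizontal v w) :
    (𝒰.tree c).dist (𝒰.treeMap c v) (𝒰.treeMap c w) ≤ 3 := by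
  obtain ⟨u, huv, hall⟩ := Vertex.exists_parent hvw.k₀_lt
  have huw := hall w hvw
  have hmeet : ∀ x : X.Vertex, Radial u x → ∀ q, IsParent q (𝒰.treeMap c x) →
      (u.ball ∩ q.set).Nonempty := fun x hx q hq =>
    ⟨x.center, hx.2 x.center_mem_ball, hq.1.2 (ball_subset_treeMap x x.center_mem_ball)⟩
  have htri := (tree_connected (𝒰 := 𝒰) (c := c)).dist_triangle
    (u := 𝒰.treeMap c v) (v := 𝒰.treeMap c u) (w := 𝒰.treeMap c w)
  rw [SimpleGraph.dist_comm (u := 𝒰.treeMap c v) (v := 𝒰.treeMap c u)] at htri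
  have hv2 := h.dist_le_two_of_radial (c := c) hk huv
  have hw2 := h.dist_le_two_of_radial (c := c) hk huw
  rcases h.treeMap_of_radial hk huv c with heq | hp | ⟨q, hq, hqv, hql⟩
  · have := congrArg (SimpleGraph.dist (𝒰.tree c) (𝒰.treeMap c u)) heq
    rw [SimpleGraph.dist_self] at this
    omega
  · rw [SimpleGraph.dist_eq_one_iff_adj.2 hp.adj] at htri
    omega
  rcases h.treeMap_of_radial hk huw c with heq | hp | ⟨q', hq', hqw, hql'⟩
  · have := congrArg (SimpleGraph.dist (𝒰.tree c) (𝒰.treeMap c u)) heq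
    rw [SimpleGraph.dist_self] at this
    omega
  · rw [SimpleGraph.dist_eq_one_iff_adj.2 hp.adj] at htri
    omega
  obtain rfl := h.eq_of_isParent_treeMap hk hq hq' hql hql' (hmeet v huv q hqv)
    (hmeet w huw q' hqw)
  have := SimpleGraph.dist_le
    (SimpleGraph.Walk.cons hqv.adj.symm (SimpleGraph.Walk.cons hqw.adj .nil))
  rw [SimpleGraph.Walk.length_cons, SimpleGraph.Walk.length_cons,
    SimpleGraph.Walk.length_nil] at this
  omega

lemma dist_le_of_descends (h : 𝒰.Adapted X) (hk : X.k₀ ≤ 0) {a : ℕ} {v x : X.Vertex}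
    (hvx : Descends a v x) : (𝒰.tree c).dist (𝒰.treeMap c v) (𝒰.treeMap c x) ≤ 2 * a := by
  induction hvx with
  | refl => simp
  | @cons a v u x huv _ ih =>
    have htri := (tree_connected (𝒰 := 𝒰) (c := c)).dist_triangle
      (u := 𝒰.treeMap c v) (v := 𝒰.treeMap c u) (w := 𝒰.treeMap c x)
    have := h.dist_le_two_of_radial (c := c) hk huv
    rw [SimpleGraph.dist_comm] at this
    omega

/-- The maps `f_c` are coarsely Lipschitz. -/
lemma dist_treeMap_le [BoundedSpace Z] [Nonempty Z] (h : 𝒰.Adapted X) (hk : X.k₀ ≤ 0) (c : C)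
    (v w : X.Vertex) :
    (𝒰.tree c).dist (𝒰.treeMap c v) (𝒰.treeMap c w) ≤ 2 * X.graph.dist v w + 1 := by
  obtain ⟨p, hp⟩ := (graph_connected (X := X)).exists_walk_length_eq_dist w v
  obtain ⟨N, hN, a, b, x, y, hvx, hwy, hxy⟩ := exists_joined p
  rw [hp, SimpleGraph.dist_comm] at hN
  have hconn := tree_connected (𝒰 := 𝒰) (c := c)
  have h1 := h.dist_le_of_descends (c := c) hk hvx
  have h2 := h.dist_le_of_descends (c := c) hk hwy
  rw [SimpleGraph.dist_comm] at h2
  have h3 := hconn.dist_triangle (u := 𝒰.treeMap c v) (v := 𝒰.treeMap c x) (w := 𝒰.treeMap c w)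
  rcases hxy with ⟨rfl, hab⟩ | ⟨hxy, hab⟩
  · omega
  · have h4 := hconn.dist_triangle (u := 𝒰.treeMap c x) (v := 𝒰.treeMap c y) (w := 𝒰.treeMap c w)
    have h5 := h.dist_le_three_of_horizontal (c := c) hk hxy
    omega

/-- The maps `f_c` are `2`-Lipschitz if the balls of adjacent vertices meet. -/
lemma dist_treeMap_le_of_inter_nonempty [BoundedSpace Z] [Nonempty Z] (h : 𝒰.Adapted X)
    (hk : X.k₀ ≤ 0) (hX : ∀ v w : X.Vertex, X.graph.Adj v w → (v.ball ∩ w.ball).Nonempty) (c : C)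
    (v w : X.Vertex) :
    (𝒰.tree c).dist (𝒰.treeMap c v) (𝒰.treeMap c w) ≤ 2 * X.graph.dist v w := by
  obtain ⟨p, hp⟩ := (graph_connected (X := X)).exists_walk_length_eq_dist v w
  rw [← hp]
  clear hp
  induction p with
  | nil => simp
  | @cons v x w hvx p ih =>
    have h1 := (tree_connected (𝒰 := 𝒰) (c := c)).dist_triangle
      (u := 𝒰.treeMap c v) (v := 𝒰.treeMap c x) (w := 𝒰.treeMap c w)
    have h2 := h.dist_le_two_of_adj (c := c) hk hvx (hX v x hvx)
    rw [SimpleGraph.Walk.length_cons]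
    omega

end Adapted

end CoverSeq

end ColoredTrees

/-! ### The lower bound -/

namespace ColoredTrees

namespace CoverSeq.Adapted

open HypApprox

variable {Z C : Type*} [MetricSpace Z] {𝒰 : CoverSeq Z C} {c : C} {r : ℝ} {X : HypApprox Z r}

lemma dist_lt_of_mem (h : 𝒰.Adapted X) {a : 𝒰.TreeVertex c} (ha : 1 ≤ a.level) {x y : Z}
    (hx : x ∈ a.set) (hy : y ∈ a.set) : dist x y < r ^ a.level := by
  have h1 : edist x y < ENNReal.ofReal (r ^ a.level) := by
    refine ((Metric.edist_le_ediam_of_mem hx hy).trans ?_).trans_lt (h.mesh_lt a.level ha)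
    exact le_iSup_of_le c (le_iSup₂_of_le a.set a.mem le_rfl)
  rw [edist_dist] at h1
  exact (ENNReal.ofReal_lt_ofReal_iff (pow_pos X.pos _)).1 h1

/-- Above the level at which `v` and `w` separate, each index contributes, in some color, an
ancestor of `f_c(v)` that is not an ancestor of `f_c(w)`. -/
lemma exists_mem_ancestors (h : 𝒰.Adapted X) (hk : X.k₀ ≤ 0) {v w : X.Vertex} {m : ℤ}
    (hsep : m < v.level → m < w.level → r ^ (m + 1) < dist v.center w.center) {j : ℕ}
    (hj : 1 ≤ j) (hmj : m + 1 ≤ j) (hjv : (j : ℤ) + 1 ≤ v.level) :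
    ∃ c, ∃ a ∈ ancestors (𝒰.treeMap c v), a ∉ ancestors (𝒰.treeMap c w) ∧ a.level = j := by
  obtain ⟨x, hx, -, hvx⟩ := v.exists_descends (k := (j : ℤ) + 1) (by omega) hjv
  obtain ⟨c, U, hU, hxU⟩ := h.ball_subset j x hx
  let a : 𝒰.TreeVertex c := ⟨(j, U), hU⟩
  have hal : a.level = j := rfl
  have hva : v.ball ⊆ a.set := hvx.ball_subset.trans hxU
  refine ⟨c, a, h.mem_ancestors_treeMap hk hva (by omega), fun haw => ?_, hal⟩
  have hw := level_treeMap_le (𝒰 := 𝒰) (c := c) w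
  have hle := level_le_of_mem_ancestors haw
  -- If `a` is an ancestor of `f_c(w)` or equal to it, then `j ≤ w.level - 1`, so `w` too has level
  -- above `m`.
  have h1 := hsep (by omega) (by omega)
  have h2 := h.dist_lt_of_mem (hal ▸ hj) (hva v.center_mem_ball)
    (set_subset_of_mem_ancestors haw (ball_subset_treeMap w w.center_mem_ball))
  have h3 : r ^ (j : ℤ) ≤ r ^ (m + 1) :=
    zpow_le_zpow_right_of_le_one₀ X.pos (by linarith [X.le_sixth]) hmj
  rw [zpow_natCast] at h3
  rw [hal] at h2
  linarith

lemma card_add_card_le_sum_dist [Fintype C] (h : 𝒰.Adapted X) (hk : X.k₀ ≤ 0) {v w : X.Vertex}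
    {J J' : Finset ℕ}
    (hJ : ∀ j ∈ J, ∃ c, ∃ a ∈ ancestors (𝒰.treeMap c v),
      a ∉ ancestors (𝒰.treeMap c w) ∧ a.level = j)
    (hJ' : ∀ j ∈ J', ∃ c, ∃ a ∈ ancestors (𝒰.treeMap c w),
      a ∉ ancestors (𝒰.treeMap c v) ∧ a.level = j) :
    J.card + J'.card ≤ ∑ c, (𝒰.tree c).dist (𝒰.treeMap c v) (𝒰.treeMap c w) := by
  classical
  -- The indices detected by the color `c`; every index is detected by at least one color.
  let K : Finset ℕ → X.Vertex → X.Vertex → C → Finset ℕ := fun J v w c =>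
    J.filter fun j => ∃ a ∈ ancestors (𝒰.treeMap c v), a ∉ ancestors (𝒰.treeMap c w) ∧ a.level = j
  have hK : ∀ (J : Finset ℕ) (v w : X.Vertex), (∀ j ∈ J, ∃ c, ∃ a ∈ ancestors (𝒰.treeMap c v),
      a ∉ ancestors (𝒰.treeMap c w) ∧ a.level = j) → J.card ≤ ∑ c, (K J v w c).card := by
    intro J v w hJ
    refine (Finset.card_le_card fun j hj => ?_).trans Finset.card_biUnion_le
    obtain ⟨c, hc⟩ := hJ j hj
    exact Finset.mem_biUnion.2 ⟨c, Finset.mem_univ c, Finset.mem_filter.2 ⟨hj, hc⟩⟩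
  refine (add_le_add (hK J v w hJ) (hK J' w v hJ')).trans ?_
  rw [← Finset.sum_add_distrib]
  exact Finset.sum_le_sum fun c _ => h.card_add_card_le_dist hk
    (fun j hj => (Finset.mem_filter.1 hj).2) fun j hj => (Finset.mem_filter.1 hj).2

lemma graph_dist_le_sum_dist [BoundedSpace Z] [Fintype C] (h : 𝒰.Adapted X) (hk : X.k₀ ≤ 0)
    (hk' : -1 ≤ X.k₀) (v w : X.Vertex) :
    X.graph.dist v w ≤ ∑ c, (𝒰.tree c).dist (𝒰.treeMap c v) (𝒰.treeMap c w) + 5 := by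
  obtain ⟨m, ⟨hm0, hmv, hmw, hmd⟩, hmax⟩ := Int.exists_greatest_of_bdd
    (P := fun m => X.k₀ ≤ m ∧ m ≤ v.level ∧ m ≤ w.level ∧ dist v.center w.center ≤ r ^ m)
    ⟨v.level, fun z hz => hz.2.1⟩ ⟨X.k₀, le_rfl, v.k₀_le, w.k₀_le,
      (Metric.dist_le_diam_of_mem (Bornology.IsBounded.all _) (Set.mem_univ _)
        (Set.mem_univ _)).trans X.isGreatest.1.le⟩
  have hsep : m < v.level → m < w.level → r ^ (m + 1) < dist v.center w.center := by
    intro h1 h2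
    by_contra! h3
    have := hmax (m + 1) ⟨by omega, by omega, by omega, h3⟩
    omega
  have hsep' : m < w.level → m < v.level → r ^ (m + 1) < dist w.center v.center := by
    intro h1 h2
    rw [dist_comm]
    exact hsep h2 h1
  have h1 := graph_dist_le hm0 hmv hmw hmd
  have h2 := h.card_add_card_le_sum_dist hk (v := v) (w := w)
    (J := Finset.Ico (max (m + 1) 1).toNat v.level.toNat)
    (J' := Finset.Ico (max (m + 1) 1).toNat w.level.toNat)
    (fun j hj => by
      rw [Finset.mem_Ico] at hj
      exact h.exists_mem_ancestors hk hsep (by omega) (by omega) (by omega))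
    (fun j hj => by
      rw [Finset.mem_Ico] at hj
      exact h.exists_mem_ancestors hk hsep' (by omega) (by omega) (by omega))
  rw [Nat.card_Ico, Nat.card_Ico] at h2
  -- The loss is 3 for `m ≥ 0`. For `m = -1`, the least value possible, the count still starts at
  -- index 1, and the loss is at most 5.
  omega

end CoverSeq.Adapted

end ColoredTrees

theorem theorem6p1 (n : ℕ) :
    ∃ a₁ a₂ b : ℝ, 0 < a₁ ∧ 0 < a₂ ∧ 0 ≤ b ∧
      ∀ (Z : Type*) [MetricSpace Z] [BoundedSpace Z] [Nontrivial Z],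
        ColoredTrees.IsCapDim Z n →
        -- for every small parameter there are covering sequences of the required kind
        (∃ r₀ : ℝ, 0 < r₀ ∧ ∀ r : ℝ, 0 < r → r < r₀ →
          ∃ 𝒰 : ColoredTrees.CoverSeq Z (Fin (n + 1)),
            ∀ X : ColoredTrees.HypApprox Z r, 𝒰.Adapted X) ∧
        -- and for every such sequence the following holds
        ∀ (r : ℝ) (X : ColoredTrees.HypApprox Z r)
          (𝒰 : ColoredTrees.CoverSeq Z (Fin (n + 1))),
          r < Metric.diam (Set.univ : Set Z) → r < 1 / Metric.diam (Set.univ : Set Z) →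
          𝒰.Adapted X →
          X.graph.Connected ∧ (∀ c, (𝒰.tree c).IsTree) ∧
          -- the product map is quasi-isometric
          (∀ v w : X.Vertex,
            a₁ * (X.graph.dist v w : ℝ) - b ≤ 𝒰.prodDist v w ∧
            𝒰.prodDist v w ≤ a₂ * (X.graph.dist v w : ℝ) + b) ∧
          -- Lipschitz estimates for the factors
          (∀ c, ∀ v w : X.Vertex,
            (𝒰.tree c).dist (𝒰.treeMap c v) (𝒰.treeMap c w) ≤ 2 * X.graph.dist v w + 1) ∧
          ((∀ v w : X.Vertex, X.graph.Adj v w → (v.ball ∩ w.ball).Nonempty) →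
            ∀ c, ∀ v w : X.Vertex,
              (𝒰.tree c).dist (𝒰.treeMap c v) (𝒰.treeMap c w) ≤ 2 * X.graph.dist v w) := by
  -- The additive constant covers both losses: 1 per color above, 5 below.
  refine ⟨1, 2 * (n + 1), n + 6, one_pos, by positivity, by positivity, ?_⟩
  intro Z _ _ _ hZ
  refine ⟨hZ.1.exists_adapted, fun r X 𝒰 hr hr' h => ?_⟩
  have hk := ColoredTrees.HypApprox.k₀_nonpos (X := X) hr
  have hk' := ColoredTrees.HypApprox.neg_one_le_k₀ (X := X) hr hr'
  refine ⟨ColoredTrees.HypApprox.graph_connected, h.isTree hk, fun v w => ⟨?_, ?_⟩,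
    h.dist_treeMap_le hk, fun hX => h.dist_treeMap_le_of_inter_nonempty hk hX⟩
  · have h1 : (X.graph.dist v w : ℝ) ≤ 𝒰.prodDist v w + 5 := by
      rw [ColoredTrees.CoverSeq.prodDist]
      exact_mod_cast h.graph_dist_le_sum_dist hk hk' v w
    have : (0 : ℝ) ≤ n := n.cast_nonneg
    linarith
  · have h1 : 𝒰.prodDist v w ≤ ∑ _c : Fin (n + 1), (2 * (X.graph.dist v w : ℝ) + 1) :=
      Finset.sum_le_sum fun c _ => by exact_mod_cast h.dist_treeMap_le hk c v w
    rw [Finset.sum_const, Finset.card_univ, Fintype.card_fin, nsmul_eq_mul] at h1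
    push_cast at h1
    linarith
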